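/- Let $p<q$ be odd primes, let $d=\gcd(p-1,q-1)$ and $N=pq$. Let $g$ be an integer that is a primitive root modulo both $p$ and $q$, and let $x$ be an integer with $x\equiv g\pmod p$ and $x\equiv 1\pmod q$. For $0\le i\le d-1$ let $$D_i=\{g^t x^i \bmod N:\ 0\le t<(p-1)(q-1)/d\}\subseteq \mathbb{Z}/N\mathbb{Z}$$ be Whiteman's generalized cyclotomic classes of order $d$, and put $$C_0=\bigcup_{j=0}^{d/2-1}D_{2j}\ \cup\ \{q,2q,\dots,(p-1)q\}\cup\{0\},\qquad C_1=\bigcup_{j=0}^{d/2-1}D_{2j+1}\ \cup\ \{p,2p,\dots,(q-1)p\},$$ which partition $\mathbb{Z}/N\mathbb{Z}$. The modified Jacobi sequence $s=(s_i)_{i\ge 0}$ of period $N$ is defined by $s_i=0$ if $i\bmod N\in C_0$ and $s_i=1$ if $i\bmod N\in C_1$. For a binary sequence $t$ (with values $0,1$) of period $N$, put $T(2)=\sum_{i=0}^{N-1}t_i2^i$; its 2-adic complexity is $$\Phi_2(t)=\left\lfloor\log_2\frac{2^N-1}{\gcd(2^N-1,\,T(2))}\right\rfloor .$$ Then $\Phi_2(s)\ge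 pq-p-q-1$. Moreover, if $q=p+2$, then the 2-adic complexity of $s$ is maximal: $\Phi_2(t)\le\Phi_2(s)$ for every binary sequence $t$ of period $N$, and $\Phi_2(s)=pq-1$. -/

import Mathlib

/-- Whiteman's generalized cyclotomic class
`D_i = {g ^ t * x ^ i : 0 ≤ t < (p - 1) * (q - 1) / d}` in `ℤ / pqℤ`. -/
def whitemanClass (p q d : ℕ) (g x : ℤ) (i : ℕ) : Finset (ZMod (p * q)) :=
  (Finset.range ((p - 1) * (q - 1) / d)).image
    (fun t => (g : ZMod (p * q)) ^ t * (x : ZMod (p * q)) ^ i)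

/-- `D₁* = D_1 ∪ D_3 ∪ ⋯ ∪ D_{d-1}`. -/
def whitemanOdd (p q d : ℕ) (g x : ℤ) : Finset (ZMod (p * q)) :=
  (Finset.range (d / 2)).biUnion (fun j => whitemanClass p q d g x (2 * j + 1))

/-- `C₁ = D₁* ∪ {p, 2p, …, (q-1)p}`. -/
def jacobiC1 (p q d : ℕ) (g x : ℤ) : Finset (ZMod (p * q)) :=
  whitemanOdd p q d g x ∪
    (Finset.Icc 1 (q - 1)).image (fun k : ℕ => (k : ZMod (p * q)) * (p : ZMod (p * q)))

/-- The modified Jacobi sequence attached to `p, q, d, g, x`: the `pq`-periodic sequence with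
`s i = 1` if `i mod pq` lies in `C₁`, and `s i = 0` if `i mod pq` lies in the complement of `C₁`,
which is `C₀ = D_0 ∪ D_2 ∪ ⋯ ∪ D_{d-2} ∪ {q, 2q, …, (p-1)q} ∪ {0}`. -/
def modifiedJacobi (p q d : ℕ) (g x : ℤ) (i : ℕ) : ℕ :=
  if (i : ZMod (p * q)) ∈ jacobiC1 p q d g x then 1 else 0

/-- `s` is a binary sequence (values `0`, `1`) with period `N`. -/
def IsBinaryOfPeriod (N : ℕ) (s : ℕ → ℕ) : Prop :=
  (∀ i, s i = 0 ∨ s i = 1) ∧ Function.Periodic s N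

/-- `S(2) = ∑_{i < N} s_i 2 ^ i`. -/
def seqValue (N : ℕ) (s : ℕ → ℕ) : ℕ := ∑ i ∈ Finset.range N, s i * 2 ^ i

/-- The 2-adic complexity `⌊log₂ ((2 ^ N - 1) / gcd (2 ^ N - 1, S(2)))⌋` of a binary sequence
with period `N`. -/
noncomputable def twoAdicComplexity (N : ℕ) (s : ℕ → ℕ) : ℤ :=
  ⌊Real.logb 2 (((2 : ℝ) ^ N - 1) / (Nat.gcd (2 ^ N - 1) (seqValue N s) : ℝ))⌋

/-- The 2-adic complexity of `s` is maximal: `s` is a binary sequence with period `N`, and no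
binary sequence with period `N` has larger 2-adic complexity. -/
def HasMaximalTwoAdicComplexity (N : ℕ) (s : ℕ → ℕ) : Prop :=
  IsBinaryOfPeriod N s ∧
    ∀ t : ℕ → ℕ, IsBinaryOfPeriod N t → twoAdicComplexity N t ≤ twoAdicComplexity N s

/-! Let `D` be the gcd in the definition of the complexity and `r` a prime factor of `D`. Modulo
`r`, `k ↦ 2 ^ k` is a nontrivial additive character of `ℤ/pq`, which the Chinese remainder theorem
splits as `φ · θ`. In the coordinates `(a, b)` the ±1 sequence `1 - 2s` is the product of the two
quadratic characters plus corrections on the axes, so `r ∣ S(2)` becomes `G(φ) G(θ) + ∑ φ - ∑ θ + 1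
= 0` in `ZMod r`, with `G` the quadratic Gauss sums (`sum_one_sub_two_mul_indicator_jacobiC1`).

As `G ^ 2 = ±p, ±q` for nontrivial characters, comparing the size of `r` with the order of 2 modulo
`r` leaves only `θ = 1`, that is, `2 ^ p = 1` and `r ∣ q - 1` (`dvd_of_dvd_seqValue`). Such an `r`
cannot divide `(2 ^ (p * q) - 1) / (2 ^ p - 1)`, hence `D ∣ 2 ^ p - 1` and the complexity is at
least `pq - p`. If `q = p + 2`, no such `r` exists and `D = 1`. -/

/-! ### Primitive roots and the quadratic character -/

theorem exists_pow_eq_of_orderOf_eq {p : ℕ} [Fact p.Prime] {a : ZMod p}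
    (ha : orderOf a = p - 1) {b : ZMod p} (hb : b ≠ 0) : ∃ k : ℕ, a ^ k = b := by
  have hp := (Fact.out : p.Prime)
  have ha0 : a ≠ 0 := by
    rintro rfl
    -- An element of infinite order has `orderOf` equal to 0, whereas `p - 1 > 0`.
    have h0 : orderOf (0 : ZMod p) = 0 := orderOf_eq_zero_iff'.2 fun n hn => by
      simp [hn.ne']
    have := hp.two_le
    omega
  have hord : orderOf (Units.mk0 a ha0) = Nat.card (ZMod p)ˣ := by
    rw [← orderOf_units, Units.val_mk0, ha, Nat.card_eq_fintype_card, ZMod.card_units]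
  have hmem : Units.mk0 b hb ∈ Subgroup.zpowers (Units.mk0 a ha0) :=
    by
    rw [Subgroup.eq_top_of_card_eq (Subgroup.zpowers (Units.mk0 a ha0)) (by rw [Nat.card_zpowers, hord])]
    exact Subgroup.mem_top _
  obtain ⟨k, hk⟩ := mem_powers_iff_mem_zpowers.2 hmem
  exact ⟨k, by simpa using congrArg Units.val hk⟩

theorem pow_eq_pow_of_modEq_orderOf {M : Type*} [Monoid M] {a : M} {m n : ℕ}
    (h : m ≡ n [MOD orderOf a]) : a ^ m = a ^ n := by
  rw [← pow_mod_orderOf, h, pow_mod_orderOf]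

theorem ringChar_zmod_ne_two {p : ℕ} (hp2 : p ≠ 2) : ringChar (ZMod p) ≠ 2 := by
  rwa [ZMod.ringChar_zmod_n]

theorem quadraticChar_eq_neg_one_of_orderOf_eq {p : ℕ} [Fact p.Prime] (hp2 : p ≠ 2)
    {a : ZMod p} (ha : orderOf a = p - 1) : quadraticChar (ZMod p) a = -1 := by
  rw [quadraticChar_neg_one_iff_not_isSquare]
  rintro ⟨c, rfl⟩
  obtain ⟨b, hb⟩ := quadraticChar_exists_neg_one (F := ZMod p) (ringChar_zmod_ne_two hp2)
  have hb0 : b ≠ 0 := by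
    rintro rfl
    simp at hb
  obtain ⟨k, rfl⟩ := exists_pow_eq_of_orderOf_eq ha hb0
  rw [quadraticChar_neg_one_iff_not_isSquare] at hb
  exact hb ⟨c ^ k, mul_pow c c k⟩

/-! ### Whiteman classes in Chinese remainder coordinates -/

/-- The two congruences for `t` are compatible exactly when `j ≡ a - b` modulo the gcd, which fixes
`j`; then `t` is found below the lcm. This makes the classes `D_0, …, D_{d-1}` exhaust the units. -/
theorem exists_whiteman_exponents {m n : ℕ} (hm : 0 < m) (hn : 0 < n) (a b : ℕ) :
    ∃ t j : ℕ, t < m * n / m.gcd n ∧ j < m.gcd n ∧ t + j ≡ a [MOD m] ∧ t ≡ b [MOD n] := by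
  have hd : 0 < m.gcd n := Nat.gcd_pos_of_pos_left n hm
  obtain ⟨c, hc⟩ : ∃ c, m.gcd n = c + 1 := ⟨m.gcd n - 1, by omega⟩
  obtain ⟨e, he⟩ : ∃ e, m = e + 1 := ⟨m - 1, by omega⟩
  -- In natural numbers, `c` plays the role of `-1` modulo the gcd, and `e` below that of `-1`
  -- modulo `m`.
  set j := (a + c * b) % m.gcd n with hj
  have hjd : b + j ≡ a [MOD m.gcd n] := by
    have h1 : j ≡ a + c * b [MOD m.gcd n] := Nat.mod_modEq _ _
    calc b + j ≡ b + (a + c * b) [MOD m.gcd n] := h1.add_left b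
      _ = a + m.gcd n * b := by rw [hc]; ring
      _ ≡ a [MOD m.gcd n] := by simp [Nat.ModEq]
  have hsub : (a + e * j) + j ≡ a [MOD m] := by
    have : (a + e * j) + j = a + m * j := by rw [he]; ring
    rw [this]
    simp [Nat.ModEq]
  have hcomp : a + e * j ≡ b [MOD m.gcd n] :=
    Nat.ModEq.add_right_cancel' j ((hsub.of_dvd (Nat.gcd_dvd_left m n)).trans hjd.symm)
  refine ⟨Nat.chineseRemainder' hcomp, j, ?_, Nat.mod_lt _ hd, ?_, ?_⟩
  · exact Nat.chineseRemainder'_lt_lcm hcomp hm.ne' hn.ne'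
  · exact ((Nat.chineseRemainder' hcomp).2.1.add_right j).trans hsub
  · exact (Nat.chineseRemainder' hcomp).2.2

/-- The element `g ^ t * x ^ j` has coordinates `(g ^ (t + j), g ^ t)`. Since `g` is a nonresidue on
both sides, the product of the characters is `(-1) ^ j`. -/
theorem mem_whitemanOdd_iff {p q d : ℕ} [Fact p.Prime] [Fact q.Prime] (hp2 : p ≠ 2) (hq2 : q ≠ 2)
    (hcop : p.Coprime q) (hd : Nat.gcd (p - 1) (q - 1) = d) {g x : ℤ}
    (hgp : orderOf (g : ZMod p) = p - 1) (hgq : orderOf (g : ZMod q) = q - 1)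
    (hxp : x ≡ g [ZMOD p]) (hxq : x ≡ 1 [ZMOD q]) (i : ZMod (p * q)) :
    i ∈ whitemanOdd p q d g x ↔
      quadraticChar (ZMod p) (ZMod.chineseRemainder hcop i).1 *
        quadraticChar (ZMod q) (ZMod.chineseRemainder hcop i).2 = -1 := by
  have hxp' : (x : ZMod p) = g := (ZMod.intCast_eq_intCast_iff x g p).2 hxp
  have hxq' : (x : ZMod q) = 1 := by
    simpa using (ZMod.intCast_eq_intCast_iff x 1 q).2 hxq
  have hrep (t j : ℕ) : ZMod.chineseRemainder hcop ((g : ZMod (p * q)) ^ t * (x : ZMod (p * q)) ^ j)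
      = ((g : ZMod p) ^ (t + j), (g : ZMod q) ^ t) := by
    rw [map_mul, map_pow, map_pow, map_intCast, map_intCast]
    ext <;> simp [hxp', hxq', pow_add]
  have hchar (t j : ℕ) : quadraticChar (ZMod p) ((g : ZMod p) ^ (t + j)) *
      quadraticChar (ZMod q) ((g : ZMod q) ^ t) = (-1) ^ j := by
    rw [map_pow, map_pow, quadraticChar_eq_neg_one_of_orderOf_eq hp2 hgp,
      quadraticChar_eq_neg_one_of_orderOf_eq hq2 hgq, pow_add, mul_right_comm, ← mul_pow]
    simp
  constructor
  · intro h
    simp only [whitemanOdd, whitemanClass, Finset.mem_biUnion, Finset.mem_image,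
      Finset.mem_range] at h
    obtain ⟨j, -, t, -, rfl⟩ := h
    rw [hrep, hchar]
    exact Odd.neg_one_pow ⟨j, rfl⟩
  · intro h
    have h1 : (ZMod.chineseRemainder hcop i).1 ≠ 0 := by
      intro h0
      simp [h0] at h
    have h2 : (ZMod.chineseRemainder hcop i).2 ≠ 0 := by
      intro h0
      simp [h0] at h
    obtain ⟨a, ha⟩ := exists_pow_eq_of_orderOf_eq hgp h1
    obtain ⟨b, hb⟩ := exists_pow_eq_of_orderOf_eq hgq h2
    have hp := (Fact.out : p.Prime).two_le
    have hq := (Fact.out : q.Prime).two_le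
    obtain ⟨t, j, ht, hj, hta, htb⟩ :=
      exists_whiteman_exponents (m := p - 1) (n := q - 1) (by omega) (by omega) a b
    rw [hd] at ht hj
    have hi : i = (g : ZMod (p * q)) ^ t * (x : ZMod (p * q)) ^ j := by
      apply (ZMod.chineseRemainder hcop).injective
      rw [hrep]
      ext
      · rw [← ha]
        exact (pow_eq_pow_of_modEq_orderOf (by rwa [hgp])).symm
      · rw [← hb]
        exact (pow_eq_pow_of_modEq_orderOf (by rwa [hgq])).symm
    rw [hi, hrep, hchar] at h
    have hodd : Odd j := by
      by_contra hne
      rw [(Nat.not_odd_iff_even.1 hne).neg_one_pow] at h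
      norm_num at h
    obtain ⟨k, rfl⟩ := hodd
    simp only [whitemanOdd, whitemanClass, Finset.mem_biUnion, Finset.mem_image, Finset.mem_range]
    exact ⟨k, by omega, t, ht, hi.symm⟩

theorem mem_jacobiC1_iff {p q d : ℕ} [Fact p.Prime] [Fact q.Prime] (hp2 : p ≠ 2) (hq2 : q ≠ 2)
    (hcop : p.Coprime q) (hd : Nat.gcd (p - 1) (q - 1) = d) {g x : ℤ}
    (hgp : orderOf (g : ZMod p) = p - 1) (hgq : orderOf (g : ZMod q) = q - 1)
    (hxp : x ≡ g [ZMOD p]) (hxq : x ≡ 1 [ZMOD q]) (i : ZMod (p * q)) :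
    i ∈ jacobiC1 p q d g x ↔
      quadraticChar (ZMod p) (ZMod.chineseRemainder hcop i).1 *
        quadraticChar (ZMod q) (ZMod.chineseRemainder hcop i).2 = -1 ∨
      (ZMod.chineseRemainder hcop i).1 = 0 ∧ (ZMod.chineseRemainder hcop i).2 ≠ 0 := by
  have hp := (Fact.out : p.Prime)
  have hq := (Fact.out : q.Prime)
  rw [jacobiC1, Finset.mem_union, mem_whitemanOdd_iff hp2 hq2 hcop hd hgp hgq hxp hxq]
  refine or_congr_right ?_
  simp only [Finset.mem_image, Finset.mem_Icc]
  constructor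
  · rintro ⟨k, ⟨hk1, hkq⟩, rfl⟩
    rw [map_mul, map_natCast, map_natCast]
    refine ⟨by simp, ?_⟩
    have hk : (k : ZMod q) ≠ 0 := by
      rw [Ne, ZMod.natCast_eq_zero_iff]
      intro h
      have := Nat.le_of_dvd (by omega) h
      omega
    have hpq : (p : ZMod q) ≠ 0 := by
      rw [Ne, ZMod.natCast_eq_zero_iff]
      intro h
      exact hq.one_lt.ne' (Nat.eq_one_of_dvd_coprimes hcop h dvd_rfl)
    simpa using ⟨hk, hpq⟩
  · rintro ⟨h1, h2⟩
    have : NeZero (p * q) := ⟨mul_ne_zero hp.ne_zero hq.ne_zero⟩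
    have hi : ((i.val : ℕ) : ZMod (p * q)) = i := ZMod.natCast_zmod_val i
    have hlt : i.val < p * q := ZMod.val_lt i
    rw [← hi, map_natCast] at h1 h2
    obtain ⟨k, hk⟩ : p ∣ i.val := (ZMod.natCast_eq_zero_iff _ _).1 (by simpa using h1)
    rw [hk] at hlt
    have hkq : k < q := Nat.lt_of_mul_lt_mul_left hlt
    have hk0 : k ≠ 0 := by
      rintro rfl
      simp [hk] at h2
    refine ⟨k, ⟨by omega, by omega⟩, ?_⟩
    rw [← hi, hk]
    push_cast
    ring

/-! ### Gauss sums and additive characters -/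

theorem sq_sum_quadraticChar_mul_addChar {p : ℕ} [Fact p.Prime] (hp2 : p ≠ 2) {F : Type*} [Field F]
    (hF : (2 : F) ≠ 0) {ψ : AddChar (ZMod p) F} (hψ : ψ ≠ 1) :
    (∑ a, (quadraticChar (ZMod p) a : F) * ψ a) ^ 2 = p ∨
      (∑ a, (quadraticChar (ZMod p) a : F) * ψ a) ^ 2 = -p := by
  set χ : MulChar (ZMod p) F := (quadraticChar (ZMod p)).ringHomComp (Int.castRingHom F) with hχ
  have hne : χ ≠ 1 := by
    obtain ⟨b, hb⟩ := quadraticChar_exists_neg_one' (F := ZMod p) (ringChar_zmod_ne_two hp2)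
    refine MulChar.ne_one_iff.2 ⟨b, fun h => hF ?_⟩
    rw [hχ, MulChar.ringHomComp_apply, hb] at h
    simp only [eq_intCast, Int.cast_neg, Int.cast_one] at h
    linear_combination -h
  have hquad : χ.IsQuadratic := (quadraticChar_isQuadratic (ZMod p)).comp _
  have h := gaussSum_sq hne hquad (AddChar.IsPrimitive.of_ne_one hψ)
  have hsum : gaussSum χ ψ = ∑ a, (quadraticChar (ZMod p) a : F) * ψ a := rfl
  rw [hsum, ZMod.card, hχ, MulChar.ringHomComp_apply] at h
  rcases quadraticChar_dichotomy (neg_ne_zero.2 (one_ne_zero (α := ZMod p))) with h1 | h1 <;>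
    rw [h1] at h
  · exact Or.inl (by simpa using h)
  · exact Or.inr (by simpa using h)

theorem sum_quadraticChar_cast {p : ℕ} [Fact p.Prime] (hp2 : p ≠ 2) {F : Type*} [Field F] :
    ∑ a, (quadraticChar (ZMod p) a : F) = 0 := by
  exact_mod_cast congrArg (Int.cast : ℤ → F)
    (quadraticChar_sum_zero (F := ZMod p) (ringChar_zmod_ne_two hp2))

theorem sum_zmod_eq_sum_range {n : ℕ} [NeZero n] {M : Type*} [AddCommMonoid M] (f : ZMod n → M) :
    ∑ i, f i = ∑ i ∈ Finset.range n, f i :=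
  Finset.sum_bij' (fun i _ => i.val) (fun i _ => (i : ZMod n))
    (fun i _ => Finset.mem_range.2 (ZMod.val_lt i)) (fun _ _ => Finset.mem_univ _)
    (fun i _ => ZMod.natCast_zmod_val i)
    (fun i hi => ZMod.val_cast_of_lt (Finset.mem_range.1 hi))
    (fun i _ => by rw [ZMod.natCast_zmod_val])

theorem addChar_chineseRemainder_symm {m n : ℕ} (h : m.Coprime n) {R : Type*} [CommRing R]
    (ψ : AddChar (ZMod (m * n)) R) (u : ZMod m × ZMod n) :
    ψ ((ZMod.chineseRemainder h).symm u) =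
      ψ.compAddMonoidHom ((ZMod.chineseRemainder h).symm.toRingHom.toAddMonoidHom.comp
        (AddMonoidHom.inl (ZMod m) (ZMod n))) u.1 *
      ψ.compAddMonoidHom ((ZMod.chineseRemainder h).symm.toRingHom.toAddMonoidHom.comp
        (AddMonoidHom.inr (ZMod m) (ZMod n))) u.2 := by
  have : u = (u.1, 0) + (0, u.2) := by simp
  conv_lhs => rw [this, map_add, AddChar.map_add_eq_mul]
  rfl

theorem addChar_eq_one_of_coprime {m n : ℕ} [NeZero m] (h : m.Coprime n) {R : Type*} [CommRing R]
    {ψ : AddChar (ZMod m) R} (hn : ψ n = 1) : ψ = 1 := by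
  by_contra hψ
  have hnat (k : ℕ) : ψ k = ψ 1 ^ k := by
    rw [← AddChar.map_nsmul_eq_pow, nsmul_one]
  have h1 := pow_gcd_eq_one.2 ⟨show ψ 1 ^ m = 1 by rw [← hnat]; simp,
    show ψ 1 ^ n = 1 by rw [← hnat, hn]⟩
  rw [h.gcd_eq_one, pow_one] at h1
  exact (AddChar.zmod_char_ne_one_iff m ψ).1 hψ h1

/-- The `±1`-valued form of the modified Jacobi sequence, summed against an additive character,
is a product of two quadratic Gauss sums up to elementary terms. -/
theorem sum_one_sub_two_mul_indicator_jacobiC1 {p q d : ℕ} [Fact p.Prime] [Fact q.Prime]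
    (hp2 : p ≠ 2) (hq2 : q ≠ 2)
    (hcop : p.Coprime q) (hd : Nat.gcd (p - 1) (q - 1) = d) {g x : ℤ}
    (hgp : orderOf (g : ZMod p) = p - 1) (hgq : orderOf (g : ZMod q) = q - 1)
    (hxp : x ≡ g [ZMOD p]) (hxq : x ≡ 1 [ZMOD q]) {F : Type*} [Field F]
    (φ : AddChar (ZMod p) F) (θ : AddChar (ZMod q) F) :
    ∑ u : ZMod p × ZMod q, (1 - 2 * if (ZMod.chineseRemainder hcop).symm u ∈ jacobiC1 p q d g x
        then (1 : F) else 0) * (φ u.1 * θ u.2) =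
      (∑ a, (quadraticChar (ZMod p) a : F) * φ a) * (∑ b, (quadraticChar (ZMod q) b : F) * θ b) +
        ∑ a, φ a - ∑ b, θ b + 1 := by
  -- The indicator products correct the axes, where the quadratic term vanishes; at the origin they
  -- give `1 - 1 + 1 = 1`, since `0 ∈ C₀`.
  have hcoef (a : ZMod p) (b : ZMod q) :
      (1 - 2 * if (ZMod.chineseRemainder hcop).symm (a, b) ∈ jacobiC1 p q d g x
        then (1 : F) else 0) =
      quadraticChar (ZMod p) a * quadraticChar (ZMod q) b + (if b = 0 then 1 else 0) -
        (if a = 0 then 1 else 0) + (if a = 0 then 1 else 0) * (if b = 0 then 1 else 0) := by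
    rw [if_congr (mem_jacobiC1_iff hp2 hq2 hcop hd hgp hgq hxp hxq _) rfl rfl,
      RingEquiv.apply_symm_apply]
    dsimp only
    by_cases ha : a = 0 <;> by_cases hb : b = 0
    · simp [ha, hb]
    · simp [ha, hb]
      ring
    · simp [ha, hb]
    · rcases quadraticChar_dichotomy ha with h1 | h1 <;>
      rcases quadraticChar_dichotomy hb with h2 | h2 <;>
      norm_num [ha, hb, h1, h2]
  rw [Fintype.sum_prod_type]
  simp only [hcoef, add_mul, sub_mul, Finset.sum_add_distrib, Finset.sum_sub_distrib]
  congr 1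
  · congr 1
    · congr 1
      · rw [Finset.sum_mul_sum]
        exact Finset.sum_congr rfl fun a _ => Finset.sum_congr rfl fun b _ => by ring
      · simp
    · rw [Finset.sum_comm]
      simp
  · simp

/-! ### Prime divisors of the gcd -/

/-- The cases are the trivialities of `φ` and `θ`. Both trivial gives `2 = 1`; only `φ` trivial
gives `r ∣ p + 1` with 2 of order `q`; neither gives `r ∣ pq ± 1` with 2 of order `pq`. Only the
case `θ = 1`, `φ ≠ 1` survives. -/
theorem dvd_of_dvd_seqValue {p q d : ℕ} [Fact p.Prime] [Fact q.Prime] (hp2 : p ≠ 2) (hpq : p < q)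
    (hd : Nat.gcd (p - 1) (q - 1) = d) {g x : ℤ}
    (hgp : orderOf (g : ZMod p) = p - 1) (hgq : orderOf (g : ZMod q) = q - 1)
    (hxp : x ≡ g [ZMOD p]) (hxq : x ≡ 1 [ZMOD q]) {r : ℕ} [Fact r.Prime]
    (hrN : r ∣ 2 ^ (p * q) - 1) (hrS : r ∣ seqValue (p * q) (modifiedJacobi p q d g x)) :
    (2 : ZMod r) ^ p = 1 ∧ r ∣ q - 1 := by
  have hp := (Fact.out : p.Prime)
  have hq := (Fact.out : q.Prime)
  have hr := (Fact.out : r.Prime)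
  have hp3 : 3 ≤ p := by
    have := hp.two_le
    omega
  have hq2 : q ≠ 2 := by omega
  have hcop : p.Coprime q := (Nat.coprime_primes hp hq).2 hpq.ne
  have hN : p * q ≠ 0 := mul_ne_zero hp.ne_zero hq.ne_zero
  have : NeZero (p * q) := ⟨hN⟩
  have hpow : (2 : ZMod r) ^ (p * q) = 1 := by
    have h := (ZMod.natCast_eq_zero_iff (2 ^ (p * q) - 1) r).2 hrN
    rw [Nat.cast_sub Nat.one_le_two_pow] at h
    push_cast at h
    linear_combination h
  have hF2 : (2 : ZMod r) ≠ 0 := by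
    intro h
    rw [h, zero_pow hN] at hpow
    exact zero_ne_one hpow
  have hr2 : r ≠ 2 := by
    rintro rfl
    exact hF2 rfl
  have hdvd {m : ℕ} (hm : m = orderOf (2 : ZMod r)) : m ∣ r - 1 := by
    rw [hm]
    exact orderOf_dvd_of_pow_eq_one (ZMod.pow_card_sub_one_eq_one hF2)
  let ψ : AddChar (ZMod (p * q)) (ZMod r) := AddChar.zmodChar (p * q) hpow
  let e := ZMod.chineseRemainder hcop
  let φ : AddChar (ZMod p) (ZMod r) := ψ.compAddMonoidHom
    (e.symm.toRingHom.toAddMonoidHom.comp (AddMonoidHom.inl (ZMod p) (ZMod q)))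
  let θ : AddChar (ZMod q) (ZMod r) := ψ.compAddMonoidHom
    (e.symm.toRingHom.toAddMonoidHom.comp (AddMonoidHom.inr (ZMod p) (ZMod q)))
  have hsplit (u : ZMod p × ZMod q) : ψ (e.symm u) = φ u.1 * θ u.2 :=
    addChar_chineseRemainder_symm hcop ψ u
  have hψnat (k : ℕ) : ψ k = 2 ^ k := AddChar.zmodChar_apply' hpow k
  have hψpow (k : ℕ) : 2 ^ k = φ k * θ k := by
    have := hsplit (e k)
    rw [RingEquiv.symm_apply_apply, hψnat, map_natCast] at this
    simpa using this
  have hψ1 : ψ ≠ 1 := by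
    refine AddChar.ne_one_iff.2 ⟨1, fun h => ?_⟩
    have h2 := hψnat 1
    rw [Nat.cast_one, h] at h2
    exact one_ne_zero (show (1 : ZMod r) = 0 by linear_combination -h2)
  have hS : ∑ i, (if i ∈ jacobiC1 p q d g x then (1 : ZMod r) else 0) * ψ i = 0 := by
    have h0 := (ZMod.natCast_eq_zero_iff _ r).2 hrS
    rw [seqValue] at h0
    push_cast at h0
    rw [sum_zmod_eq_sum_range]
    refine Eq.trans ?_ h0
    refine Finset.sum_congr rfl fun i _ => ?_
    rw [hψnat, modifiedJacobi]
    push_cast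
    rfl
  have htot : ∑ u : ZMod p × ZMod q, (1 - 2 * if e.symm u ∈ jacobiC1 p q d g x
      then (1 : ZMod r) else 0) * (φ u.1 * θ u.2) = 0 := by
    simp only [← hsplit]
    refine (e.symm.toEquiv.sum_comp (fun i => (1 - 2 * if i ∈ jacobiC1 p q d g x
      then (1 : ZMod r) else 0) * ψ i)).trans ?_
    simp only [sub_mul, one_mul, Finset.sum_sub_distrib, mul_assoc, ← Finset.mul_sum]
    rw [hS, AddChar.sum_eq_zero_of_ne_one hψ1]
    ring
  rw [sum_one_sub_two_mul_indicator_jacobiC1 hp2 hq2 hcop hd hgp hgq hxp hxq φ θ] at htot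
  have hφ1 (h : φ = 1) : (2 : ZMod r) ^ q = 1 := by
    rw [hψpow, h]
    simp
  have hθ1 (h : θ = 1) : (2 : ZMod r) ^ p = 1 := by
    rw [hψpow, h]
    simp
  -- Here `m + 1 ≤ r ≤ n ≤ m + 1` forces `r = m + 1`, which is even, while `r` is odd. It is applied
  -- with `m` the order of 2.
  have hle {m n : ℕ} (hm : m ∣ r - 1) (hn : r ∣ n) (hn0 : n ≠ 0) (hnm : n ≤ m + 1)
      (hm2 : Odd m) : False := by
    have h0 := hr.two_le
    have h1 := Nat.le_of_dvd (by omega) hm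
    have h2 := Nat.le_of_dvd (Nat.pos_of_ne_zero hn0) hn
    have hrm : r = m + 1 := by omega
    exact Nat.not_even_iff_odd.2 (hr.odd_of_ne_two hr2) (hrm ▸ hm2.add_one)
  have hpodd : Odd p := hp.odd_of_ne_two hp2
  have hqodd : Odd q := hq.odd_of_ne_two hq2
  have h21 : (2 : ZMod r) ≠ 1 := by
    intro h
    exact one_ne_zero (show (1 : ZMod r) = 0 by linear_combination h)
  by_cases hφ : φ = 1
  · by_cases hθ : θ = 1
    · exfalso
      apply h21
      have := hψpow 1
      rw [hφ, hθ] at this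
      simpa using this
    · exfalso
      have hord : q = orderOf (2 : ZMod r) := (orderOf_eq_prime (hφ1 hφ) h21).symm
      rw [AddChar.sum_eq_zero_of_ne_one hθ, hφ] at htot
      simp only [AddChar.one_apply, mul_one, sum_quadraticChar_cast hp2] at htot
      have h0 : ((p + 1 : ℕ) : ZMod r) = 0 := by
        push_cast
        simpa using htot
      exact hle (hdvd hord) ((ZMod.natCast_eq_zero_iff _ _).1 h0) (by omega) (by omega) hqodd
  · by_cases hθ : θ = 1
    · refine ⟨hθ1 hθ, ?_⟩
      rw [AddChar.sum_eq_zero_of_ne_one hφ, hθ] at htot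
      simp only [AddChar.one_apply, mul_one, sum_quadraticChar_cast hq2] at htot
      rw [← ZMod.natCast_eq_zero_iff, Nat.cast_sub hq.one_le]
      simp at htot
      push_cast
      linear_combination -htot
    · exfalso
      -- `2 ^ q = φ q` and `2 ^ p = θ p`; as `q` generates `ZMod p` additively and `p` generates
      -- `ZMod q`, neither value is 1.
      have hord : p * q = orderOf (2 : ZMod r) := by
        refine (orderOf_eq_of_pow_and_pow_div_prime (Nat.pos_of_ne_zero hN) hpow ?_).symm
        intro l hl hlN
        rcases (hl.dvd_mul).1 hlN with h | h
        · obtain rfl := (Nat.prime_dvd_prime_iff_eq hl hp).1 h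
          rw [Nat.mul_div_cancel_left _ hl.pos]
          intro h2
          have h3 := hψpow q
          rw [h2, ZMod.natCast_self q, AddChar.map_zero_eq_one, mul_one] at h3
          exact hφ (addChar_eq_one_of_coprime hcop h3.symm)
        · obtain rfl := (Nat.prime_dvd_prime_iff_eq hl hq).1 h
          rw [Nat.mul_div_cancel _ hl.pos]
          intro h2
          have h3 := hψpow p
          rw [h2, ZMod.natCast_self p, AddChar.map_zero_eq_one, one_mul] at h3
          exact hθ (addChar_eq_one_of_coprime hcop.symm h3.symm)
      rw [AddChar.sum_eq_zero_of_ne_one hφ, AddChar.sum_eq_zero_of_ne_one hθ] at htot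
      -- Only the squares of the Gauss sums are known, up to sign, so the relation `G(φ) G(θ) = -1`
      -- is squared to get `±pq = 1`.
      have hsq : ((∑ a, (quadraticChar (ZMod p) a : ZMod r) * φ a) *
          (∑ b, (quadraticChar (ZMod q) b : ZMod r) * θ b)) ^ 2 = 1 := by
        have : (∑ a, (quadraticChar (ZMod p) a : ZMod r) * φ a) *
          (∑ b, (quadraticChar (ZMod q) b : ZMod r) * θ b) = -1 := by linear_combination htot
        rw [this]
        ring
      rw [mul_pow] at hsq
      have hpq9 : 9 ≤ p * q := by nlinarith
      have hpm : r ∣ p * q - 1 ∨ r ∣ p * q + 1 := by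
        simp only [← ZMod.natCast_eq_zero_iff]
        rw [Nat.cast_sub (by omega)]
        push_cast
        rcases sq_sum_quadraticChar_mul_addChar hp2 hF2 hφ with h1 | h1 <;>
        rcases sq_sum_quadraticChar_mul_addChar hq2 hF2 hθ with h2 | h2 <;>
        rw [h1, h2] at hsq
        · exact Or.inl (by linear_combination hsq)
        · exact Or.inr (by linear_combination -hsq)
        · exact Or.inr (by linear_combination -hsq)
        · exact Or.inl (by linear_combination hsq)
      rcases hpm with h | h
      · exact hle (hdvd hord) h (by omega) (by omega) (hpodd.mul hqodd)
      · exact hle (hdvd hord) h (by omega) le_rfl (hpodd.mul hqodd)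

/-! ### From the gcd to the 2-adic complexity -/

theorem two_pow_mul_sub_one_eq (m n : ℕ) :
    2 ^ (m * n) - 1 = (2 ^ m - 1) * ∑ k ∈ Finset.range n, (2 ^ m) ^ k := by
  rw [pow_mul, mul_comm]
  exact (geom_sum_mul_of_one_le Nat.one_le_two_pow n).symm

theorem gcd_seqValue_pos {N : ℕ} (hN : N ≠ 0) (s : ℕ → ℕ) :
    0 < Nat.gcd (2 ^ N - 1) (seqValue N s) :=
  Nat.gcd_pos_of_pos_left _ (Nat.sub_pos_of_lt (Nat.one_lt_two_pow hN))

/-- The bound `2 ^ c - 1`, rather than `2 ^ c`, absorbs the `-1` in `2 ^ N - 1`: `2 ^ (N - c) * (2 ^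
c - 1) ≤ 2 ^ N - 1`. No loss occurs in the floor. -/
theorem sub_le_twoAdicComplexity {N c : ℕ} (hN : N ≠ 0) (hc : c ≤ N) {s : ℕ → ℕ}
    (h : Nat.gcd (2 ^ N - 1) (seqValue N s) ≤ 2 ^ c - 1) :
    (N : ℤ) - c ≤ twoAdicComplexity N s := by
  have hpos : (0 : ℝ) < Nat.gcd (2 ^ N - 1) (seqValue N s) := by
    exact_mod_cast gcd_seqValue_pos hN s
  have h' : (Nat.gcd (2 ^ N - 1) (seqValue N s) : ℝ) ≤ 2 ^ c - 1 := by
    have := (Nat.cast_le (α := ℝ)).2 h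
    rwa [Nat.cast_sub Nat.one_le_two_pow, Nat.cast_pow, Nat.cast_ofNat, Nat.cast_one] at this
  rw [twoAdicComplexity, Int.le_floor, ← Nat.cast_sub hc, Int.cast_natCast]
  have hNc : (2 : ℝ) ^ N = 2 ^ (N - c) * 2 ^ c := by rw [← pow_add, Nat.sub_add_cancel hc]
  have h1 : (1 : ℝ) ≤ 2 ^ (N - c) := one_le_pow₀ one_le_two
  have hle : (2 : ℝ) ^ (N - c) ≤ (2 ^ N - 1) / Nat.gcd (2 ^ N - 1) (seqValue N s) := by
    rw [le_div_iff₀ hpos]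
    calc (2 : ℝ) ^ (N - c) * Nat.gcd (2 ^ N - 1) (seqValue N s)
        ≤ 2 ^ (N - c) * (2 ^ c - 1) := by gcongr
      _ ≤ 2 ^ N - 1 := by rw [hNc]; linarith
  rw [Real.le_logb_iff_rpow_le one_lt_two (lt_of_lt_of_le (by positivity) hle),
    Real.rpow_natCast]
  exact hle

theorem twoAdicComplexity_le {N : ℕ} (hN : N ≠ 0) (s : ℕ → ℕ) :
    twoAdicComplexity N s ≤ N - 1 := by
  have hpos : (1 : ℝ) ≤ Nat.gcd (2 ^ N - 1) (seqValue N s) := by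
    exact_mod_cast gcd_seqValue_pos hN s
  have hN1 : (1 : ℝ) < 2 ^ N := one_lt_pow₀ one_lt_two hN
  rw [Int.le_sub_one_iff, twoAdicComplexity, Int.floor_lt, Int.cast_natCast,
    Real.logb_lt_iff_lt_rpow one_lt_two (div_pos (by linarith) (by linarith)), Real.rpow_natCast,
    div_lt_iff₀ (by linarith)]
  nlinarith

theorem modifiedJacobi_isBinaryOfPeriod (p q d : ℕ) (g x : ℤ) :
    IsBinaryOfPeriod (p * q) (modifiedJacobi p q d g x) := by
  refine ⟨fun i => ?_, fun i => ?_⟩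
  · unfold modifiedJacobi
    split_ifs
    · exact Or.inr rfl
    · exact Or.inl rfl
  · simp only [modifiedJacobi, Nat.cast_add (R := ZMod (p * q)) i (p * q),
      ZMod.natCast_self, add_zero]

theorem theorem2 (p q d : ℕ) (hp : p.Prime) (hq : q.Prime) (hp2 : p ≠ 2) (hpq : p < q)
    (hd : Nat.gcd (p - 1) (q - 1) = d) (g x : ℤ)
    (hgp : orderOf (g : ZMod p) = p - 1) (hgq : orderOf (g : ZMod q) = q - 1)
    (hxp : x ≡ g [ZMOD p]) (hxq : x ≡ 1 [ZMOD q]) :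
    (p * q - p - q - 1 : ℤ) ≤ twoAdicComplexity (p * q) (modifiedJacobi p q d g x) ∧
    (q = p + 2 →
      HasMaximalTwoAdicComplexity (p * q) (modifiedJacobi p q d g x) ∧
      twoAdicComplexity (p * q) (modifiedJacobi p q d g x) = (p * q - 1 : ℤ)) := by
  have : Fact p.Prime := ⟨hp⟩
  have : Fact q.Prime := ⟨hq⟩
  have hN : p * q ≠ 0 := mul_ne_zero hp.ne_zero hq.ne_zero
  set D := Nat.gcd (2 ^ (p * q) - 1) (seqValue (p * q) (modifiedJacobi p q d g x)) with hD
  have hprime (r : ℕ) (hr : r.Prime) (hrD : r ∣ D) : (2 : ZMod r) ^ p = 1 ∧ r ∣ q - 1 := by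
    have : Fact r.Prime := ⟨hr⟩
    exact dvd_of_dvd_seqValue hp2 hpq hd hgp hgq hxp hxq (hrD.trans (Nat.gcd_dvd_left _ _))
      (hrD.trans (Nat.gcd_dvd_right _ _))
  -- Modulo a common prime factor `r`, `2 ^ p = 1` turns the sum into `q`, so `r` divides both `q`
  -- and `q - 1`.
  have hcop : D.Coprime (∑ k ∈ Finset.range q, (2 ^ p) ^ k) := by
    refine Nat.Coprime.symm (Nat.coprime_of_dvd' fun r hr hr1 hr2 => ?_)
    obtain ⟨h2, hrq⟩ := hprime r hr hr2
    have h0 := (ZMod.natCast_eq_zero_iff _ r).2 hr1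
    push_cast at h0
    rw [h2] at h0
    simp only [one_pow, Finset.sum_const, Finset.card_range, nsmul_eq_mul, mul_one] at h0
    have hrq' := (ZMod.natCast_eq_zero_iff q r).1 h0
    have := Nat.dvd_sub hrq' hrq
    rwa [Nat.sub_sub_self hq.one_le] at this
  have hDp : D ∣ 2 ^ p - 1 := by
    refine hcop.dvd_of_dvd_mul_right ?_
    rw [← two_pow_mul_sub_one_eq]
    exact Nat.gcd_dvd_left _ _
  have hDle : D ≤ 2 ^ p - 1 :=
    Nat.le_of_dvd (Nat.sub_pos_of_lt (Nat.one_lt_two_pow hp.ne_zero)) hDp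
  refine ⟨?_, fun hqp => ?_⟩
  -- This gives `pq - p`, more than is asked.
  · have := sub_le_twoAdicComplexity hN (Nat.le_mul_of_pos_right p hq.pos) hDle
    push_cast at this
    linarith
  · have hD1 : D = 1 := by
      by_contra hne
      obtain ⟨r, hr, hrD⟩ := Nat.exists_prime_and_dvd hne
      have : Fact r.Prime := ⟨hr⟩
      obtain ⟨h2, hrq⟩ := hprime r hr hrD
      have h21 : (2 : ZMod r) ≠ 1 := by
        intro h
        exact one_ne_zero (show (1 : ZMod r) = 0 by linear_combination h)
      have h20 : (2 : ZMod r) ≠ 0 := by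
        intro h
        rw [h, zero_pow hp.ne_zero] at h2
        exact zero_ne_one h2
      have hpr : p ∣ r - 1 := by
        rw [← orderOf_eq_prime h2 h21]
        exact orderOf_dvd_of_pow_eq_one (ZMod.pow_card_sub_one_eq_one h20)
      have hr2 : r ≠ 2 := by
        rintro rfl
        exact h20 rfl
      have h0 := hr.two_le
      have h1 := Nat.le_of_dvd (by omega) hpr
      have h3 := Nat.le_of_dvd (by omega) hrq
      -- `p ∣ r - 1` gives `r ≥ p + 1`, and `r ∣ q - 1 = p + 1` gives the reverse; but `p + 1` is
      -- even.
      have hrp : r = p + 1 := by omega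
      exact Nat.not_even_iff_odd.2 (hr.odd_of_ne_two hr2) (hrp ▸ (hp.odd_of_ne_two hp2).add_one)
    have hmax : twoAdicComplexity (p * q) (modifiedJacobi p q d g x) = (p * q - 1 : ℤ) := by
      refine le_antisymm (by exact_mod_cast twoAdicComplexity_le hN _) ?_
      have := sub_le_twoAdicComplexity (c := 1) hN (Nat.one_le_iff_ne_zero.2 hN)
        (s := modifiedJacobi p q d g x) (by rw [← hD, hD1]; norm_num)
      exact_mod_cast this
    refine ⟨⟨modifiedJacobi_isBinaryOfPeriod p q d g x, fun t _ => ?_⟩, hmax⟩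
    rw [hmax]
    exact_mod_cast twoAdicComplexity_le hN t
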